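/- An order-$n$ $d$-dimensional Latin hypercube is a $0$-$1$ array $A$ indexed by $[n]^{d+1}$ with exactly one $1$ in every line (a line is obtained by fixing all but one of the $d+1$ indices). A transversal of $A$ is a set of $n$ positions $x\in[n]^{d+1}$ with $A(x)=1$ that contains exactly one position from each hyperplane $\{x : x_i=a\}$ ($1\le i\le d+1$, $a\in[n]$). Let $T(d,n)$ be the maximum number of transversals in an order-$n$ $d$-dimensional Latin hypercube. Theorem. For every $d\ge 3$ there are an infinite set $S\subseteq\mathbb{N}$ and a function $\varepsilon:\mathbb{N}\to\mathbb{R}$ with $\varepsilon(N)\to 0$ as $N\to\infty$ such that, for every $N\in S$, $$T(d,N)\ \ge\ \left((1-\varepsilon(N))\,\frac{N^{d-1}}{e^d}\right)^{N}.$$ -/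

import Mathlib

/-- An order-`n` `d`-dimensional Latin hypercube in its 0-1 representation: a 0-1 array indexed by
`[n]^(d+1)` (`true` stands for `1`) with exactly one `1` in every line. The line through `x` in
direction `i` consists of the elements `Function.update x i a`, where `a` ranges over `[n]`. -/
def IsLatinHypercube (d n : ℕ) (A : (Fin (d + 1) → Fin n) → Bool) : Prop :=
  ∀ (i : Fin (d + 1)) (x : Fin (d + 1) → Fin n), ∃! a : Fin n, A (Function.update x i a) = true

/-- A transversal of `A`: a set of `n` elements of `A` carrying a `1`, exactly one of them in each
hyperplane `{x | x i = a}`. -/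
def IsTransversal {d n : ℕ} (A : (Fin (d + 1) → Fin n) → Bool)
    (X : Finset (Fin (d + 1) → Fin n)) : Prop :=
  X.card = n ∧ (∀ x ∈ X, A x = true) ∧
    ∀ (i : Fin (d + 1)) (a : Fin n), ∃! x : Fin (d + 1) → Fin n, x ∈ X ∧ x i = a

instance (d n : ℕ) (A : (Fin (d + 1) → Fin n) → Bool) : Decidable (IsLatinHypercube d n A) := by
  unfold IsLatinHypercube ExistsUnique; infer_instance

instance {d n : ℕ} (A : (Fin (d + 1) → Fin n) → Bool) (X : Finset (Fin (d + 1) → Fin n)) :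
    Decidable (IsTransversal A X) := by
  unfold IsTransversal ExistsUnique; infer_instance

/-- The number of transversals of `A`. -/
def numTransversals {d n : ℕ} (A : (Fin (d + 1) → Fin n) → Bool) : ℕ :=
  (Finset.univ.filter fun X : Finset (Fin (d + 1) → Fin n) => IsTransversal A X).card

/-- `T(d, n)`: the maximum number of transversals in an order-`n` `d`-dimensional Latin
hypercube (a maximum over a finite nonempty set). -/
def maxTransversals (d n : ℕ) : ℕ :=
  (Finset.univ.filter fun A : (Fin (d + 1) → Fin n) → Bool => IsLatinHypercube d n A).sup
    fun A => numTransversals A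

set_option linter.unusedSectionVars false

/-! Averaging over random Latin hypercubes of order `N = h * m`, where `m = h ^ (d - 1) * s`.
Arrange `h ^ d` blocks of order `m` as the zero-sum hypercube on a group of order `h`, and fill them
with independent random isotopes of the zero-sum hypercube on a group of order `m`.

Look for transversals with exactly `s` positions in each block. A `Labelling` distributes the
hyperplanes to such positions; there are `m! ^ (h * (d + 1))` of them (`card_labelling`), and each
transversal arises from at most `s! ^ (h ^ d)` (`card_fits_le`). By symmetry and greedy counting, a
block contains its `s` prescribed positions with probability about `m ^ (-s)` at least
(`le_numIsotopesThrough`). Some choice of isotopes reaches the average. For `h = s = k`, `N = k ^ (d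
+ 1)`, Stirling turns this into `(m ^ d / (e ^ d * k)) ^ N` up to a factor `(1 - o(1)) ^ N`, and `m
^ d / k = N ^ (d - 1)`. -/

section TransversalBound

open Finset

/-- Sequences chosen greedily so as to avoid a conflict relation `R` of degree at most `D`. -/
theorem pow_le_card_conflictFree {V : Type*} [Fintype V] [DecidableEq V] (R : V → V → Prop)
    [DecidableRel R] (D n : ℕ) (hD : ∀ x, #{y | R x y} ≤ D) (k : ℕ) (hk : k ≤ n) :
    (Fintype.card V - n * D) ^ k ≤ #{f : Fin k → V | ∀ i j, i < j → ¬ R (f i) (f j)} := by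
  induction k with
  | zero => simp
  | succ k ih =>
    rw [pow_succ']
    refine (Nat.mul_le_mul_left _ (ih (by omega))).trans ?_
    refine mul_card_image_le_card_of_maps_to (f := fun f : Fin (k + 1) → V => Fin.init f) ?_ _ ?_
    · intro f hf
      simp only [mem_filter, mem_univ, true_and] at hf ⊢
      intro i j hij
      exact hf _ _ (Fin.castSucc_lt_castSucc_iff.2 hij)
    · intro g hg
      simp only [mem_filter, mem_univ, true_and] at hg
      have hinj : Function.Injective (fun y : V => (Fin.snoc g y : Fin (k + 1) → V)) := by
        intro y z hyz
        simpa using congrFun hyz (Fin.last k)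
      have hfree : Fintype.card V - n * D ≤ #{y | ∀ i, ¬ R (g i) y} := by
        have h1 : (univ.biUnion fun i : Fin k => ({y | R (g i) y} : Finset V))ᶜ ⊆
            ({y | ∀ i, ¬ R (g i) y} : Finset V) := by
          intro y; simp
        refine le_trans ?_ (card_le_card h1)
        rw [card_compl]
        refine Nat.sub_le_sub_left (card_biUnion_le.trans ((sum_le_sum fun i _ => hD (g i)).trans ?_)) _
        simpa using Nat.mul_le_mul_right D (by omega : k ≤ n)
      refine hfree.trans ?_
      rw [← card_map ⟨_, hinj⟩]
      refine card_le_card ?_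
      intro f
      simp only [mem_map, mem_filter, mem_univ, true_and, Function.Embedding.coeFn_mk]
      rintro ⟨y, hy, rfl⟩
      refine ⟨?_, by simp⟩
      intro i j hij
      induction j using Fin.lastCases with
      | last =>
        induction i using Fin.lastCases with
        | last => exact absurd hij (lt_irrefl _)
        | cast i => simpa using hy i
      | cast j =>
        induction i using Fin.lastCases with
        | last => exact absurd hij (not_lt.2 (Fin.le_last _))
        | cast i => simpa using hg i j (Fin.castSucc_lt_castSucc_iff.1 hij)

/-! ### Zero-sum tuples over an abelian group -/

/-- The tuple with zero sum that extends `y` by a coordinate in front. -/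
def zeroSumExt {d : ℕ} {G : Type*} [AddCommGroup G] : (Fin d → G) →+ (Fin (d + 1) → G) where
  toFun y := Fin.cons (-∑ i, y i) y
  map_zero' := by
    ext i; refine Fin.cases ?_ (fun i => ?_) i <;> simp
  map_add' x y := by
    ext i; refine Fin.cases ?_ (fun i => ?_) i <;> simp [sum_add_distrib, add_comm]

section zeroSumExt

variable {d : ℕ} {G : Type*} [AddCommGroup G]

@[simp] theorem zeroSumExt_zero (y : Fin d → G) : zeroSumExt y 0 = -∑ i, y i := rfl

@[simp] theorem zeroSumExt_succ (y : Fin d → G) (i : Fin d) : zeroSumExt y i.succ = y i := rfl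

theorem tail_zeroSumExt (y : Fin d → G) : Fin.tail (zeroSumExt y) = y := rfl

theorem zeroSumExt_injective : Function.Injective (zeroSumExt : (Fin d → G) → Fin (d + 1) → G) :=
  fun x y h => by rw [← tail_zeroSumExt x, h, tail_zeroSumExt]

theorem sum_zeroSumExt (y : Fin d → G) : ∑ i, zeroSumExt y i = 0 := by
  simp [Fin.sum_univ_succ]

theorem exists_zeroSumExt_apply_eq (hd : 0 < d) (i : Fin (d + 1)) (a : G) :
    ∃ y : Fin d → G, zeroSumExt y i = a := by
  refine Fin.cases ⟨Pi.single ⟨0, hd⟩ (-a), ?_⟩ (fun i => ⟨fun _ => a, by simp⟩) i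
  simp

theorem card_zeroSumExt_apply_eq [Fintype G] [DecidableEq G] (hd : 0 < d) (i : Fin (d + 1))
    (a : G) : #{y : Fin d → G | zeroSumExt y i = a} = Fintype.card G ^ (d - 1) := by
  -- Fibres of a surjective homomorphism have equal size, so each is `1 / |G|` of the whole.
  have h1 : ∀ b : G, #{y : Fin d → G | zeroSumExt y i = b} =
      #{y : Fin d → G | zeroSumExt y i = a} := fun b =>
    AddMonoidHom.card_fiber_eq_of_mem_range
      ((Pi.evalAddMonoidHom (fun _ : Fin (d + 1) => G) i).comp zeroSumExt)
      (exists_zeroSumExt_apply_eq hd i b) (exists_zeroSumExt_apply_eq hd i a)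
  have h2 : #(univ : Finset (Fin d → G)) = ∑ b : G, #{y : Fin d → G | zeroSumExt y i = b} :=
    card_eq_sum_card_fiberwise fun _ _ => mem_coe.2 (mem_univ _)
  simp only [h1, sum_const, card_univ, smul_eq_mul, Fintype.card_fun, Fintype.card_fin] at h2
  obtain ⟨e, rfl⟩ : ∃ e, d = e + 1 := ⟨d - 1, by omega⟩
  rw [pow_succ'] at h2
  exact (Nat.eq_of_mul_eq_mul_left (Fintype.card_pos_iff.2 ⟨a⟩) h2).symm

end zeroSumExt

/-! ### Random isotopes through a prescribed partial diagonal -/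

section Isotopes

variable {d s : ℕ} {K : Type*} [AddCommGroup K] [Fintype K] [DecidableEq K]

/-- There are many partial transversals of size `s` in the hypercube of zero-sum tuples. -/
theorem pow_le_card_partialTransversal (hd : 0 < d) :
    (Fintype.card K ^ d - s * ((d + 1) * Fintype.card K ^ (d - 1))) ^ s ≤
      #{t : Fin (d + 1) → (Fin s ↪ K) | ∀ j, ∑ i, t i j = 0} := by
  have h := pow_le_card_conflictFree
    (fun x y : Fin d → K => ∃ i, zeroSumExt y i = zeroSumExt x i)
    ((d + 1) * Fintype.card K ^ (d - 1)) s (fun x => by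
      have h1 : ({y | ∃ i, zeroSumExt y i = zeroSumExt x i} : Finset (Fin d → K)) ⊆
          univ.biUnion fun i => {y | zeroSumExt y i = zeroSumExt x i} := by
        intro y; simp
      refine (card_le_card h1).trans (card_biUnion_le.trans ?_)
      simp [card_zeroSumExt_apply_eq hd]) s le_rfl
  rw [Fintype.card_fun, Fintype.card_fin] at h
  refine h.trans ?_
  have hinj : ∀ f ∈ ({f : Fin s → Fin d → K | ∀ i j, i < j →
      ¬ ∃ l, zeroSumExt (f j) l = zeroSumExt (f i) l} : Finset _),
      ∀ i, Function.Injective fun j => zeroSumExt (f j) i := by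
    intro f hf i j k hjk
    simp only [mem_filter, mem_univ, true_and] at hf
    rcases lt_trichotomy j k with h | h | h
    · exact absurd ⟨i, hjk.symm⟩ (hf _ _ h)
    · exact h
    · exact absurd ⟨i, hjk⟩ (hf _ _ h)
  refine card_le_card_of_surjOn (fun t j => Fin.tail fun i => t i j) fun f hf => ?_
  refine ⟨fun i => ⟨_, hinj f hf i⟩, ?_, rfl⟩
  simpa using fun j => sum_zeroSumExt (f j)

/-- The number of isotopes of the hypercube of zero-sum tuples that contain the partial diagonal
`j ↦ (u i j)ᵢ`. -/
def numIsotopesThrough (u : Fin (d + 1) → (Fin s ↪ K)) : ℕ :=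
  #{σ : Fin (d + 1) → Equiv.Perm K | ∀ j, ∑ i, σ i (u i j) = 0}

/-- Permutations `ρ i` carrying `u i` to `v i` exist, and composing with them matches the isotopes
through `v` with those through `u`. -/
theorem numIsotopesThrough_eq (u v : Fin (d + 1) → (Fin s ↪ K)) :
    numIsotopesThrough u = numIsotopesThrough v := by
  choose ρ hρ using fun i =>
    Equiv.Perm.exists_extending_pair (u i) (v i) (u i).injective (v i).injective
  refine (card_equiv (Equiv.mulRight ρ) fun σ => ?_).symm
  simp [hρ]

/-- Double counting of pairs (diagonal, isotope): every isotope contains equally many partial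
diagonals, every partial diagonal lies in equally many isotopes. -/
theorem le_numIsotopesThrough (hd : 0 < d) (u : Fin (d + 1) → (Fin s ↪ K)) :
    (Fintype.card K).factorial ^ (d + 1) *
        (Fintype.card K ^ d - s * ((d + 1) * Fintype.card K ^ (d - 1))) ^ s ≤
      Fintype.card K ^ (s * (d + 1)) * numIsotopesThrough u := by
  have h1 : ∑ v : Fin (d + 1) → (Fin s ↪ K), numIsotopesThrough v =
      ∑ σ : Fin (d + 1) → Equiv.Perm K,
        #{v : Fin (d + 1) → (Fin s ↪ K) | ∀ j, ∑ i, σ i (v i j) = 0} :=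
    sum_card_bipartiteAbove_eq_sum_card_bipartiteBelow
      (fun (v : Fin (d + 1) → (Fin s ↪ K)) (σ : Fin (d + 1) → Equiv.Perm K) =>
        ∀ j, ∑ i, σ i (v i j) = 0)
  have h2 : ∀ σ : Fin (d + 1) → Equiv.Perm K,
      #{v : Fin (d + 1) → (Fin s ↪ K) | ∀ j, ∑ i, σ i (v i j) = 0} =
      #{t : Fin (d + 1) → (Fin s ↪ K) | ∀ j, ∑ i, t i j = 0} := fun σ =>
    card_equiv (Equiv.piCongrRight fun i => Equiv.embeddingCongr (Equiv.refl _) (σ i))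
      fun v => by simp
  have h3 : ∀ v : Fin (d + 1) → (Fin s ↪ K), numIsotopesThrough v = numIsotopesThrough u :=
    fun v => numIsotopesThrough_eq v u
  simp only [h2, h3, sum_const, card_univ, smul_eq_mul] at h1
  simp only [Fintype.card_pi, Fintype.card_perm, Fintype.card_embedding_eq, prod_const, card_univ,
    Fintype.card_fin] at h1
  calc _ ≤ (Fintype.card K).factorial ^ (d + 1) *
        #{t : Fin (d + 1) → (Fin s ↪ K) | ∀ j, ∑ i, t i j = 0} :=
        Nat.mul_le_mul_left _ (pow_le_card_partialTransversal hd)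
    _ = _ := h1.symm
    _ ≤ _ := by
        rw [pow_mul]
        gcongr
        exact Nat.descFactorial_le_pow _ _

end Isotopes

/-! ### Block hypercubes and their expected number of transversals -/

section Blocks

variable {d s N : ℕ} {H K : Type*} [AddCommGroup H] [Fintype H] [DecidableEq H]
  [AddCommGroup K] [Fintype K] [DecidableEq K]

/-- The hypercube whose blocks are arranged as the zero-sum hypercube on `H`, the block `c` being
the isotope `ω c` of the zero-sum hypercube on `K`. -/
def blockHypercube (e : Fin N ≃ H × K) (ω : (Fin d → H) → Fin (d + 1) → Equiv.Perm K)
    (x : Fin (d + 1) → Fin N) : Bool :=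
  decide (∑ i, (e (x i)).1 = 0 ∧ ∑ i, ω (Fin.tail fun i => (e (x i)).1) i (e (x i)).2 = 0)

theorem isLatinHypercube_blockHypercube (e : Fin N ≃ H × K)
    (ω : (Fin d → H) → Fin (d + 1) → Equiv.Perm K) :
    IsLatinHypercube d N (blockHypercube e ω) := by
  intro i x
  have h1 : ∀ a : Fin N, (fun j => (e (Function.update x i a j)).1) =
      Function.update (fun j => (e (x j)).1) i (e a).1 := fun a => by
    ext j; by_cases h : j = i
    · subst h; simp
    · simp [h]
  have h2 : ∀ (a : Fin N) (c : Fin d → H), (fun j => ω c j (e (Function.update x i a j)).2) =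
      Function.update (fun j => ω c j (e (x j)).2) i (ω c i (e a).2) := fun a c => by
    ext j; by_cases h : j = i
    · subst h; simp
    · simp [h]
  -- The outer coordinate is forced first; it fixes the block, whose isotope then forces the inner
  -- one.
  have h3 : ∀ a : Fin N, blockHypercube e ω (Function.update x i a) = true ↔
      (e a).1 = -∑ j ∈ univ \ {i}, (e (x j)).1 ∧
      (e a).2 = (ω (Fin.tail (Function.update (fun j => (e (x j)).1) i
        (-∑ j ∈ univ \ {i}, (e (x j)).1))) i).symm
        (-∑ j ∈ univ \ {i}, ω (Fin.tail (Function.update (fun j => (e (x j)).1) i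
        (-∑ j ∈ univ \ {i}, (e (x j)).1))) j (e (x j)).2) := fun a => by
    rw [blockHypercube, decide_eq_true_iff, h1, h2, sum_update_of_mem (mem_univ i),
      sum_update_of_mem (mem_univ i), add_eq_zero_iff_eq_neg, add_eq_zero_iff_eq_neg]
    constructor
    · rintro ⟨h, h'⟩
      rw [h] at h'
      exact ⟨h, by rw [Equiv.eq_symm_apply, h']⟩
    · rintro ⟨h, h'⟩
      rw [Equiv.eq_symm_apply] at h'
      exact ⟨h, by rw [h, h']⟩
  simp only [h3]
  have h4 : ∀ (p : H) (q : K), ∃! a : Fin N, (e a).1 = p ∧ (e a).2 = q := fun p q =>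
    ⟨e.symm (p, q), by simp, fun b hb => by
      rw [Equiv.eq_symm_apply]
      exact Prod.ext hb.1 hb.2⟩
  exact h4 _ _

/-- A labelling distributes, for each direction `i` and each layer `a` of blocks in this direction,
the hyperplanes of the layer among the slots `(c, j)` with `c` a block of this layer. -/
abbrev Labelling (d s : ℕ) (H K : Type*) [AddCommGroup H] :=
  (i : Fin (d + 1)) → (a : H) → ({p : (Fin d → H) × Fin s // zeroSumExt p.1 i = a} ≃ K)

/-- The hyperplane in direction `i` given by a labelling to a slot. -/
def Labelling.coordEquiv (β : Labelling d s H K) (i : Fin (d + 1)) :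
    (Fin d → H) × Fin s ≃ H × K :=
  (Equiv.sigmaFiberEquiv fun p : (Fin d → H) × Fin s => zeroSumExt p.1 i).symm.trans
    ((Equiv.sigmaCongrRight (β i)).trans (Equiv.sigmaEquivProd H K))

theorem Labelling.coordEquiv_apply (β : Labelling d s H K) (i : Fin (d + 1))
    (p : (Fin d → H) × Fin s) :
    β.coordEquiv i p = (zeroSumExt p.1 i, β i (zeroSumExt p.1 i) ⟨p, rfl⟩) := rfl

/-- The hyperplanes given by a labelling to the slots of one block. -/
def Labelling.cellEmbedding (β : Labelling d s H K) (c : Fin d → H) (i : Fin (d + 1)) :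
    Fin s ↪ K where
  toFun j := β i (zeroSumExt c i) ⟨(c, j), rfl⟩
  inj' j k h := by simpa using h

/-- The positions determined by a labelling. -/
def Labelling.positions (e : Fin N ≃ H × K) (β : Labelling d s H K) :
    Finset (Fin (d + 1) → Fin N) :=
  univ.image fun p i => e.symm (β.coordEquiv i p)

/-- All the positions determined by the labelling belong to the isotopes `ω`. -/
abbrev Labelling.Fits (β : Labelling d s H K)
    (ω : (Fin d → H) → Fin (d + 1) → Equiv.Perm K) : Prop :=
  ∀ c j, ∑ i, ω c i (β.cellEmbedding c i j) = 0

theorem Labelling.Fits.isTransversal (e : Fin N ≃ H × K) {β : Labelling d s H K}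
    {ω : (Fin d → H) → Fin (d + 1) → Equiv.Perm K} (h : β.Fits ω) :
    IsTransversal (blockHypercube e ω) (β.positions e) := by
  have hinj : ∀ i, Function.Injective fun p => e.symm (β.coordEquiv i p) := fun i =>
    e.symm.injective.comp (β.coordEquiv i).injective
  refine ⟨?_, ?_, ?_⟩
  · rw [positions, card_image_of_injective _ fun p q hpq => hinj 0 (congrFun hpq 0), card_univ,
      Fintype.card_congr ((β.coordEquiv 0).trans e.symm), Fintype.card_fin]
  · intro x hx
    obtain ⟨⟨c, j⟩, -, rfl⟩ := mem_image.1 hx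
    simp only [blockHypercube, Equiv.apply_symm_apply, coordEquiv_apply, sum_zeroSumExt,
      tail_zeroSumExt, decide_eq_true_eq, true_and]
    exact h c j
  · intro i a
    refine ⟨fun k => e.symm (β.coordEquiv k ((β.coordEquiv i).symm (e a))),
      ⟨mem_image_of_mem _ (mem_univ _), by simp⟩, ?_⟩
    rintro x ⟨hx, rfl⟩
    obtain ⟨p, -, rfl⟩ := mem_image.1 hx
    simp

/-- Relabelling the slots inside each block. -/
def Labelling.permute (β : Labelling d s H K) (τ : (Fin d → H) → Equiv.Perm (Fin s)) :
    Labelling d s H K := fun i a =>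
  ((Equiv.prodShear (Equiv.refl (Fin d → H)) τ).subtypeEquiv fun _ => Iff.rfl).trans (β i a)

theorem Labelling.exists_permute_eq (e : Fin N ≃ H × K) {β γ : Labelling d s H K}
    (h : γ.positions e = β.positions e) : ∃ τ, β.permute τ = γ := by
  have h1 : ∀ c j, ∃ k, ∀ i, γ.coordEquiv i (c, j) = β.coordEquiv i (c, k) := by
    intro c j
    have h2 : (fun i => e.symm (γ.coordEquiv i (c, j))) ∈ β.positions e := by
      rw [← h]; exact mem_image_of_mem _ (mem_univ _)
    obtain ⟨⟨c', k⟩, -, hk⟩ := mem_image.1 h2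
    have h3 : ∀ i, β.coordEquiv i (c', k) = γ.coordEquiv i (c, j) := fun i =>
      e.symm.injective (congrFun hk i)
    -- The outer coordinates of a position reveal its block.
    have h4 : c' = c := zeroSumExt_injective (funext fun i => congrArg Prod.fst (h3 i))
    subst h4
    exact ⟨k, fun i => (h3 i).symm⟩
  choose t ht using h1
  have hinj : ∀ c, Function.Injective (t c) := fun c j k hjk => by
    have := (γ.coordEquiv 0).injective ((ht c j 0).trans (by rw [hjk, ← ht c k 0]))
    simpa using this
  refine ⟨fun c => Equiv.ofBijective (t c) (Finite.injective_iff_bijective.1 (hinj c)), ?_⟩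
  funext i a
  ext ⟨⟨c, j⟩, rfl⟩
  exact (congrArg Prod.snd (ht c j i)).symm

theorem card_fits_le (e : Fin N ≃ H × K) (ω : (Fin d → H) → Fin (d + 1) → Equiv.Perm K) :
    #{β : Labelling d s H K | β.Fits ω} ≤
      s.factorial ^ (Fintype.card H ^ d) * numTransversals (blockHypercube e ω) := by
  refine card_le_mul_card_image_of_maps_to (f := Labelling.positions e) (fun β hβ => ?_) _
    fun X _ => ?_
  · simp only [mem_filter, mem_univ, true_and] at hβ ⊢
    exact hβ.isTransversal e
  · rcases ({β ∈ {β : Labelling d s H K | β.Fits ω} | β.positions e = X} :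
      Finset _).eq_empty_or_nonempty with h | ⟨β, hβ⟩
    · rw [h]; simp
    · have h1 : Fintype.card ((Fin d → H) → Equiv.Perm (Fin s)) =
          s.factorial ^ (Fintype.card H ^ d) := by
        simp [Fintype.card_perm]
      rw [← h1, ← card_univ]
      refine card_le_card_of_surjOn (fun τ => β.permute τ) fun γ hγ => ?_
      simp only [coe_filter, mem_filter, mem_univ, true_and, Set.mem_ofPred_eq] at hγ hβ
      obtain ⟨τ, hτ⟩ := Labelling.exists_permute_eq e (hγ.2.trans hβ.2.symm)
      exact ⟨τ, mem_coe.2 (mem_univ _), hτ⟩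

/-- `hK` says that a layer's `h ^ (d - 1)` blocks of `s` slots use up exactly its `m` hyperplanes.
-/
theorem card_labelling (hd : 0 < d) (hK : Fintype.card K = Fintype.card H ^ (d - 1) * s) :
    Fintype.card (Labelling d s H K) =
      (Fintype.card K).factorial ^ (Fintype.card H * (d + 1)) := by
  have h1 : ∀ (i : Fin (d + 1)) (a : H),
      Fintype.card {p : (Fin d → H) × Fin s // zeroSumExt p.1 i = a} = Fintype.card K := by
    intro i a
    rw [Fintype.card_subtype, hK, ← card_zeroSumExt_apply_eq hd i a]
    have : ({p : (Fin d → H) × Fin s | zeroSumExt p.1 i = a} : Finset _) =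
        ({y | zeroSumExt y i = a} : Finset (Fin d → H)) ×ˢ univ := by
      ext p; simp
    rw [this, card_product, card_univ, Fintype.card_fin]
  have h2 : ∀ (i : Fin (d + 1)) (a : H),
      Fintype.card ({p : (Fin d → H) × Fin s // zeroSumExt p.1 i = a} ≃ K) =
        (Fintype.card K).factorial := fun i a => by
    rw [Fintype.card_equiv (Fintype.equivOfCardEq (h1 i a)), h1]
  rw [Fintype.card_pi]
  simp only [Fintype.card_pi, h2, prod_const, card_univ, Fintype.card_fin, pow_mul]

theorem card_isotopes_fits (β : Labelling d s H K) :
    #{ω | β.Fits ω} = ∏ c, numIsotopesThrough (β.cellEmbedding c) := by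
  unfold numIsotopesThrough
  rw [← Fintype.card_piFinset]
  congr 1
  ext ω
  simp [Labelling.Fits]

/-- First moment argument with denominators cleared: if every `ω` fell short, so would the number of
fitting pairs `(ω, β)`. -/
theorem exists_le_numTransversals_blockHypercube (hd : 0 < d)
    (hK : Fintype.card K = Fintype.card H ^ (d - 1) * s) (e : Fin N ≃ H × K) :
    ∃ ω : (Fin d → H) → Fin (d + 1) → Equiv.Perm K,
      (Fintype.card K).factorial ^ (Fintype.card H * (d + 1)) *
        ((Fintype.card K ^ d - s * ((d + 1) * Fintype.card K ^ (d - 1))) ^ s) ^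
          (Fintype.card H ^ d) ≤
      (Fintype.card K ^ (s * (d + 1))) ^ (Fintype.card H ^ d) *
        (s.factorial ^ (Fintype.card H ^ d) * numTransversals (blockHypercube e ω)) := by
  by_contra! hlt
  set m := Fintype.card K with hm
  set h := Fintype.card H with hh
  set R := (m ^ d - s * ((d + 1) * m ^ (d - 1))) ^ s
  have h1 : ∑ ω : (Fin d → H) → Fin (d + 1) → Equiv.Perm K,
      #{β : Labelling d s H K | β.Fits ω} =
      ∑ β : Labelling d s H K, #{ω | β.Fits ω} :=
    sum_card_bipartiteAbove_eq_sum_card_bipartiteBelow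
      (fun (ω : (Fin d → H) → Fin (d + 1) → Equiv.Perm K) (β : Labelling d s H K) => β.Fits ω)
  have h2 : ∀ β : Labelling d s H K, (m.factorial ^ (d + 1)) ^ (h ^ d) * R ^ (h ^ d) ≤
      (m ^ (s * (d + 1))) ^ (h ^ d) * #{ω | β.Fits ω} := fun β => by
    rw [card_isotopes_fits, ← mul_pow]
    have hcard : Fintype.card (Fin d → H) = h ^ d := by simp [hh]
    rw [← hcard, ← card_univ, ← prod_const, ← prod_const, ← prod_mul_distrib]
    exact prod_le_prod' fun c _ => le_numIsotopesThrough hd _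
  have h3 : (m.factorial ^ (d + 1)) ^ (h ^ d) * (m.factorial ^ (h * (d + 1)) * R ^ (h ^ d)) ≤
      ∑ ω : (Fin d → H) → Fin (d + 1) → Equiv.Perm K,
        (m ^ (s * (d + 1))) ^ (h ^ d) * #{β : Labelling d s H K | β.Fits ω} := by
    rw [← mul_sum, h1, mul_sum]
    calc _ = ∑ _β : Labelling d s H K, (m.factorial ^ (d + 1)) ^ (h ^ d) * R ^ (h ^ d) := by
          rw [sum_const, card_univ, card_labelling hd hK, smul_eq_mul]; ring
      _ ≤ _ := sum_le_sum fun β _ => h2 β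
  have h4 : ∑ ω : (Fin d → H) → Fin (d + 1) → Equiv.Perm K,
        (m ^ (s * (d + 1))) ^ (h ^ d) * #{β : Labelling d s H K | β.Fits ω} <
      ∑ _ω : (Fin d → H) → Fin (d + 1) → Equiv.Perm K,
        m.factorial ^ (h * (d + 1)) * R ^ (h ^ d) :=
    sum_lt_sum_of_nonempty univ_nonempty fun ω _ =>
      (Nat.mul_le_mul_left _ (card_fits_le e ω)).trans_lt (hlt ω)
  rw [sum_const, card_univ, smul_eq_mul] at h4
  have h5 : Fintype.card ((Fin d → H) → Fin (d + 1) → Equiv.Perm K) =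
      (m.factorial ^ (d + 1)) ^ (h ^ d) := by
    simp [Fintype.card_perm, hm, hh]
  rw [h5] at h4
  exact absurd h3 (not_le.2 h4)

end Blocks

/-- The quantitative bound for order `h ^ d * s`, with blocks of order `h ^ (d - 1) * s`. -/
theorem le_maxTransversals_mul {d : ℕ} (hd : 0 < d) {h s m : ℕ} (hh : 0 < h) (hs : 0 < s)
    (hm : m = h ^ (d - 1) * s) :
    m.factorial ^ (h * (d + 1)) *
        ((m ^ d - s * ((d + 1) * m ^ (d - 1))) ^ s) ^ (h ^ d) ≤
      (m ^ (s * (d + 1))) ^ (h ^ d) *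
        (s.factorial ^ (h ^ d) * maxTransversals d (h * m)) := by
  have hm0 : 0 < m := by rw [hm]; positivity
  have : NeZero h := ⟨hh.ne'⟩
  have : NeZero m := ⟨hm0.ne'⟩
  have e : Fin (h * m) ≃ ZMod h × ZMod m := by
    refine (Fintype.equivFinOfCardEq ?_).symm
    simp [ZMod.card]
  obtain ⟨ω, hω⟩ := exists_le_numTransversals_blockHypercube (H := ZMod h) (K := ZMod m) (s := s) hd
    (by simpa [ZMod.card] using hm) e
  simp only [ZMod.card] at hω
  refine hω.trans ?_
  gcongr
  exact le_sup (f := fun A => numTransversals A)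
    (mem_filter.2 ⟨mem_univ _, isLatinHypercube_blockHypercube e ω⟩)

/-! ### Asymptotics -/

theorem pow_div_exp_le_factorial (m : ℕ) :
    ((m : ℝ) / Real.exp 1) ^ m ≤ (m.factorial : ℝ) := by
  rcases Nat.eq_zero_or_pos m with rfl | hm
  · simp
  refine le_trans ?_ (Stirling.le_factorial_stirling m)
  refine le_mul_of_one_le_left (by positivity) (Real.one_le_sqrt.2 ?_)
  have h1 : (1 : ℝ) ≤ m := by exact_mod_cast hm
  nlinarith [Real.pi_gt_three]

theorem factorial_le_exp_mul_sqrt_mul_pow {k : ℕ} (hk : 0 < k) :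
    (k.factorial : ℝ) ≤ Real.exp 1 * √k * ((k : ℝ) / Real.exp 1) ^ k := by
  have h := Stirling.stirlingSeq'_antitone (Nat.zero_le (k - 1))
  simp only [Function.comp_apply, Nat.succ_eq_add_one, Nat.sub_add_cancel hk, zero_add,
    Stirling.stirlingSeq] at h
  have h0 : (0 : ℝ) < k := by exact_mod_cast hk
  rw [div_le_iff₀ (by positivity), Real.sqrt_mul (by norm_num)] at h
  have h2 : √2 ≠ 0 := by positivity
  refine h.trans (le_of_eq ?_)
  field_simp
  simp

/-- The relative loss in the transversal bound for order `x ^ (d + 1)`. -/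
noncomputable def transversalFactor (d : ℕ) (x : ℝ) : ℝ :=
  Real.exp (-((1 + Real.log x / 2) / x)) * (1 - (d + 1) / x ^ (d - 1))

theorem tendsto_transversalFactor {d : ℕ} (hd : 2 ≤ d) :
    Filter.Tendsto (transversalFactor d) Filter.atTop (nhds 1) := by
  have h1 : Filter.Tendsto (fun x : ℝ => (1 + Real.log x / 2) / x) Filter.atTop (nhds 0) := by
    have h := (tendsto_inv_atTop_zero (𝕜 := ℝ)).add
      (Real.isLittleO_log_id_atTop.tendsto_div_nhds_zero.div_const 2)
    simp only [zero_div, add_zero, id] at h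
    refine h.congr fun x => ?_
    ring
  have h2 : Filter.Tendsto (fun x : ℝ => ((d : ℝ) + 1) / x ^ (d - 1)) Filter.atTop (nhds 0) :=
    tendsto_const_nhds.div_atTop (Filter.tendsto_pow_atTop (by omega))
  have h3 := ((Real.continuous_exp.tendsto _).comp h1.neg).mul (h2.const_sub 1)
  unfold transversalFactor
  simpa using h3

theorem le_maxTransversals {d k : ℕ} (hd : 2 ≤ d) (hk : d + 1 ≤ k) :
    (transversalFactor d k * (((k ^ (d + 1) : ℕ) : ℝ) ^ (d - 1) / Real.exp (d : ℝ))) ^ (k ^ (d + 1)) ≤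
      (maxTransversals d (k ^ (d + 1)) : ℝ) := by
  have hk0 : 0 < k := by omega
  have hkr : (0 : ℝ) < k := by exact_mod_cast hk0
  obtain ⟨c, rfl⟩ : ∃ c, d = c + 1 := ⟨d - 1, by omega⟩
  have hm : k ^ (c + 1) = k ^ (c + 1 - 1) * k := by simp [pow_succ]
  have hmain := le_maxTransversals_mul (d := c + 1) (by omega) hk0 hk0 hm
  rw [← pow_succ' k (c + 1)] at hmain
  simp only [Nat.add_sub_cancel] at hmain ⊢
  set N := k ^ (c + 1 + 1) with hN
  set m := k ^ (c + 1) with hmdef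
  have hkm : k * m = N := by rw [hN, hmdef, pow_succ' k (c + 1)]
  have hm0 : 0 < m := by positivity
  have hmr : (0 : ℝ) < m := by exact_mod_cast hm0
  set δ : ℝ := 1 - ((c + 1 : ℕ) + 1) / (k : ℝ) ^ c with hδ
  have hmk : (m : ℝ) = (k : ℝ) ^ c * k := by rw [hmdef, pow_succ]; push_cast; rfl
  have hδ0 : 0 ≤ δ := by
    rw [hδ, sub_nonneg, div_le_one (by positivity)]
    have h1 : k ≤ k ^ c := Nat.le_self_pow (by omega) k
    exact_mod_cast hk.trans h1
  have hδm : (m : ℝ) ^ (c + 1) * δ ≤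
      ((m ^ (c + 1) - k * ((c + 1 + 1) * m ^ c) : ℕ) : ℝ) := by
    have h1 : (m : ℝ) ^ (c + 1) ≤ ((m ^ (c + 1) - k * ((c + 1 + 1) * m ^ c) : ℕ) : ℝ) +
        (k * ((c + 1 + 1) * m ^ c) : ℕ) := by
      exact_mod_cast le_tsub_add
    refine le_trans (le_of_eq ?_) (sub_le_iff_le_add.2 h1)
    have h2 : (m : ℝ) * (((c + 1 : ℕ) + 1) / (k : ℝ) ^ c) = ((c + 1 : ℕ) + 1) * k := by
      rw [hmk]; field_simp
    rw [hδ]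
    push_cast at h2 ⊢
    linear_combination -((m : ℝ) ^ c) * h2
  have hmainr : (m.factorial : ℝ) ^ (k * (c + 1 + 1)) *
      (((m ^ (c + 1) - k * ((c + 1 + 1) * m ^ c) : ℕ) : ℝ) ^ k) ^ m ≤
      ((m : ℝ) ^ (k * (c + 1 + 1))) ^ m * ((k.factorial : ℝ) ^ m * maxTransversals (c + 1) N) := by
    exact_mod_cast hmain
  have hlow : (((m : ℝ) / Real.exp 1) ^ (c + 2) * ((m : ℝ) ^ (c + 1) * δ)) ^ N ≤
      (m.factorial : ℝ) ^ (k * (c + 1 + 1)) *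
      (((m ^ (c + 1) - k * ((c + 1 + 1) * m ^ c) : ℕ) : ℝ) ^ k) ^ m := by
    rw [mul_pow, ← pow_mul _ k m, hkm]
    gcongr
    calc _ = (((m : ℝ) / Real.exp 1) ^ m) ^ (k * (c + 1 + 1)) := by
          rw [← pow_mul, ← pow_mul, ← hkm]; congr 1; ring
      _ ≤ _ := by gcongr; exact pow_div_exp_le_factorial m
  set θ : ℝ := Real.exp (-((1 + Real.log k / 2) / k)) with hθ
  have hfac : (θ ^ N) * (k.factorial : ℝ) ^ m ≤ ((k : ℝ) / Real.exp 1) ^ N := by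
    -- The exponent in `θ` is chosen to cancel the subexponential factor `e * √k` of `k!`, which
    -- occurs once per `k` of the `N` positions.
    have h1 : θ ^ k * (Real.exp 1 * √k) = 1 := by
      have h2 : √(k : ℝ) = Real.exp (Real.log k / 2) := by
        rw [Real.sqrt_eq_rpow, Real.rpow_def_of_pos hkr]; congr 1; ring
      rw [hθ, h2, ← Real.exp_nat_mul, ← Real.exp_add, ← Real.exp_add, Real.exp_eq_one_iff]
      field_simp
      ring
    rw [← hkm, pow_mul, pow_mul, ← mul_pow]
    gcongr
    calc _ ≤ θ ^ k * (Real.exp 1 * √k * ((k : ℝ) / Real.exp 1) ^ k) := by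
          gcongr; exact factorial_le_exp_mul_sqrt_mul_pow hk0
      _ = _ := by rw [← mul_assoc, h1, one_mul]
  have hpos : (0 : ℝ) < ((m : ℝ) ^ (c + 2)) ^ N * (k.factorial : ℝ) ^ m := by positivity
  -- The factors `m ^ ((c + 2) * N)` and `k! ^ m` are the denominators of the averaging bound.
  refine le_of_mul_le_mul_right (a := ((m : ℝ) ^ (c + 2)) ^ N * (k.factorial : ℝ) ^ m) ?_ hpos
  calc _ = ((δ * ((N : ℝ) ^ c / Real.exp ((c + 1 : ℕ) : ℝ))) ^ N * ((m : ℝ) ^ (c + 2)) ^ N) *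
        (θ ^ N * (k.factorial : ℝ) ^ m) := by
        have : transversalFactor (c + 1) k = θ * δ := by
          simp [transversalFactor, hθ, hδ]
        rw [this, mul_assoc θ, mul_pow θ]; ring
    _ ≤ ((δ * ((N : ℝ) ^ c / Real.exp ((c + 1 : ℕ) : ℝ))) ^ N * ((m : ℝ) ^ (c + 2)) ^ N) *
        ((k : ℝ) / Real.exp 1) ^ N := by gcongr
    _ = (((m : ℝ) / Real.exp 1) ^ (c + 2) * ((m : ℝ) ^ (c + 1) * δ)) ^ N := by
        rw [← mul_pow, ← mul_pow]
        congr 1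
        have h1 : Real.exp ((c + 1 : ℕ) : ℝ) = Real.exp 1 ^ (c + 1) := by
          rw [← Real.exp_nat_mul, mul_one]
        have h2 : (N : ℝ) ^ c * k = (m : ℝ) ^ (c + 1) := by
          rw [hmk, ← hkm]; push_cast; rw [hmk]; ring
        rw [h1, ← h2, div_pow]
        field_simp
        ring
    _ ≤ _ := hlow.trans (hmainr.trans (le_of_eq ?_))
  have h3 : ((m : ℝ) ^ (k * (c + 1 + 1))) ^ m = ((m : ℝ) ^ (c + 2)) ^ N := by
    rw [← pow_mul, ← pow_mul, ← hkm]; congr 1; ring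
  rw [h3]; ring

end TransversalBound

theorem theorem3 (d : ℕ) (hd : 3 ≤ d) :
    ∃ S : Set ℕ, S.Infinite ∧ ∃ ε : ℕ → ℝ, Filter.Tendsto ε Filter.atTop (nhds 0) ∧
      ∀ N ∈ S, ((1 - ε N) * ((N : ℝ) ^ (d - 1) / Real.exp (d : ℝ))) ^ N ≤
        (maxTransversals d N : ℝ) := by
  refine ⟨{N | ∃ k, d + 1 ≤ k ∧ N = k ^ (d + 1)}, ?_,
    -- On `S` the real root of `N` is exactly `k`; elsewhere only the limit matters.
    fun N => 1 - transversalFactor d ((N : ℝ) ^ (((d + 1 : ℕ) : ℝ)⁻¹)), ?_, ?_⟩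
  · refine Set.infinite_of_forall_exists_gt fun a => ⟨_, ⟨a + (d + 1), by omega, rfl⟩, ?_⟩
    exact lt_of_lt_of_le (by omega) (Nat.le_self_pow (by omega : d + 1 ≠ 0) (a + (d + 1)))
  · have h1 : Filter.Tendsto (fun N : ℕ => (N : ℝ) ^ (((d + 1 : ℕ) : ℝ)⁻¹)) Filter.atTop
        Filter.atTop :=
      (tendsto_rpow_atTop (by positivity)).comp tendsto_natCast_atTop_atTop
    simpa using ((tendsto_transversalFactor (by omega : 2 ≤ d)).comp h1).const_sub 1
  · rintro N ⟨k, hk, rfl⟩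
    have h1 : ((k ^ (d + 1) : ℕ) : ℝ) ^ (((d + 1 : ℕ) : ℝ)⁻¹) = k := by
      rw [Nat.cast_pow, Real.pow_rpow_inv_natCast (by positivity) (by omega)]
    simp only [h1, sub_sub_cancel]
    exact le_maxTransversals (by omega) hk
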